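/- **Setting.** A library of $m$ files of $F$ bits is given, and each of $n$ users in the unit square caches the equivalent of $M>0$ files; transmissions are heard within distance $r\ge\sqrt2$, so every user hears every transmission, and one user transmits at a time. Let $q=\frac mM$ and $c$ be positive integers and let $t'=\frac{n'M}{m}\ge 2$ be an integer such that $c(t'-1)=\frac mM-1$. Each file is split into $K'=q^{t'}$ equal packets $W_{f,\ell}$, $\ell\in\{0,\dots,q-1\}^{t'}$; the $n'=t'q$ packet sets are $\mathcal Z_{i,j}=\{W_{f,\ell}:\ell_i=j\}$. Each user independently picks one of the $n'$ packet sets uniformly at random and caches it; $x_{i,j}$ denotes the number of users caching $\mathcal Z_{i,j}$. Suppose that all packet sets are cached. The delivery phase runs in rounds $k=0,1,2,\dots$. In round $k$ one takes, for every $(i,j)$, a user $u_{i,j}$ caching $\mathcal Z_{i,j}$: a not yet served one if there is one (i.e. if $k<x_{i,j}$), otherwise an already served one, which now requests empty packets. For every lattice point $p\in\{0,\dots,q-1\}^{t'}$ the users $u_{0,p_0},\dots,u_{t'-1,p_{t'-1}}$ form a multicasting group. Groups all of whose members were already served are ignored; in every other group each member $i$ sends $c$ coded packets, for $a=0,\dots,c-1$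 the XOR over the other members $s$ of the requested packet of $u_{s,p_s}$ at the lattice point obtained from $p$ by adding $((s-i)\bmod t')+a(t'-1)$ to $p_s$ modulo $q$. This is repeated until all users are served. The rate $R^{\rm hc}_{\rm d}(M)$ is the total number of transmitted bits divided by $F$, i.e. the number of coded packets divided by $K'$. **Theorem.** 1. If $n\ge\beta n'\log n'$ for some $\beta>1$, then with probability at least $1-{n'}^{1-\beta}$ all packet sets are cached in the network. 2. Whenever all packet sets are cached, the scheme can be carried out; each user caches $MF$ bits, each coded packet is a function of its sender's cache, and each user recovers its requested file from its cache and the received coded packets, for every demand vector. 3. Let $\alpha>1$ be fixed and let $n'\to\infty$, the other parameters varying with $n'$ subject to the above. In each of the following three regimes, with probability $1-o(1)$ all packet sets are cached and $$R^{\rm hc}_{\rm d}(M)\le k_\alpha\,\frac{t'}{t'-1}\,\frac mM\Bigl(1-\frac Mm\Bigr),$$ where $$k_\alpha=\begin{cases}(d_\beta-1+\alpha)\log n', & \text{if } n=(\beta+o(1))\,n'\log n' \text{ for a constant }\beta>1,\\[2pt] \dfrac n{n'}+\alpha\sqrt{\dfrac{2n}{n'}\log n'}, & \text{if } n=\omega(n'\log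 n'),\\[6pt] \dfrac n{n'}+\sqrt{\dfrac{2n\log n'}{n'}}\Bigl(1-\dfrac1\alpha\,\dfrac{\log\log n'}{2\log n'}\Bigr), & \text{if } n=\omega\bigl(n'(\log n')^3\bigr),\end{cases}$$ and $d_\beta$ is a number depending only on $\beta$, namely the largest root $x>0$ of $1+x(\log\beta-\log x+1)-\beta=0$. (The second bound holds in particular for $\omega(n'\log n')=n\le n'\,\mathrm{polylog}(n')$. In the third regime both the second and the third bound hold.) -/

import Mathlib

open Filter Topology MeasureTheory ProbabilityTheory Asymptotics

namespace D2D

/-- Labels `(i, j)` of the packet sets (hyperplanes) of the hypercube with `t` dimensions and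
`q` lattice points per dimension. -/
abbrev PacketSet (t q : ℕ) : Type := Fin t × Fin q

/-- Lattice points; they index the `q ^ t` packets of each file. -/
abbrev Lattice (t q : ℕ) : Type := Fin t → Fin q

/-- A packet of `B` bits. -/
abbrev Packet (B : ℕ) : Type := Fin B → ZMod 2

/-- The contents of a library of `m` files, each made of `q ^ t` packets of `B` bits
(so a file has `F = q ^ t * B` bits). -/
abbrev Library (m t q B : ℕ) : Type := Fin m → Lattice t q → Packet B

/-- The packets of a file that belong to the packet set `z = (i, j)`: the points of the
hyperplane `ℓ_i = j`. -/
def hyperplane {t q : ℕ} (z : PacketSet t q) : Finset (Lattice t q) :=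
  Finset.univ.filter fun p => p z.1 = z.2

/-- The system parameters: `m` files, cache size of `M` files, `q = m / M` a positive integer,
`n'` dummy users, `t = n' M / m ≥ 2` an integer, and `c (t - 1) = m / M - 1` with `c` a positive
integer. -/
structure Params (n' m c t q : ℕ) (M : ℝ) : Prop where
  M_pos : 0 < M
  q_eq : (q : ℝ) = m / M
  q_pos : 0 < q
  c_pos : 0 < c
  t_eq : (t : ℝ) = n' * M / m
  two_le_t : 2 ≤ t
  symm : (c : ℝ) * ((t : ℝ) - 1) = m / M - 1

section Placement

variable {n t q : ℕ}

/-- The law of the decentralized placement: each of the `n` users independently picks one of the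
packet sets uniformly at random. -/
noncomputable def placementLaw (n t q : ℕ) : Measure (Fin n → PacketSet t q) :=
  Measure.pi fun _ => uniformOn Set.univ

/-- The number of users that cache the packet set `z`. -/
def load (Z : Fin n → PacketSet t q) (z : PacketSet t q) : ℕ :=
  (Finset.univ.filter fun u => Z u = z).card

/-- Every packet set is cached by at least one user. -/
def AllCached (Z : Fin n → PacketSet t q) : Prop := ∀ z, ∃ u, Z u = z

end Placement

section Delivery

/- The delivery phase proceeds in rounds `k = 0, 1, 2, …`.  Let `X` be the matrix of the numbers of
unsatisfied users per packet set; at the beginning of round `k` its entry at `z` is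
`max 0 (load Z z - k)`, since each round serves one unsatisfied user of every packet set that still
has one (doing `x` rounds at once, where `x` is the minimum non-zero entry of `X`, is the same
thing).  Hence this entry is non-zero exactly when `k < load Z z`. -/

variable {n t q : ℕ}

/-- A schedule: `g k z` is the user taking part in round `k` for the packet set `z`.  As long as
there are unsatisfied users caching `z`, i.e. for `k < load Z z`, it is a new one (the sets of newly
served users of different rounds are disjoint); afterwards it is any user that caches `z`. -/
structure IsSchedule (Z : Fin n → PacketSet t q) (g : ℕ → PacketSet t q → Fin n) : Prop where
  caches : ∀ k z, Z (g k z) = z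
  disjoint : ∀ z, Set.InjOn (fun k => g k z) (Set.Iio (load Z z))

/-- A transmission `(k, p, i, a)`: in round `k`, within the multicasting group of the lattice point
`p` (its members are the users `g k (s, p s)` for the dimensions `s`), the `a`-th of the `c` coded
packets sent by the member of dimension `i`. -/
abbrev Transmission (n t q c : ℕ) : Type := Fin n × Lattice t q × Fin t × Fin c

/-- The transmissions that are made: in each round the multicasting groups all of whose members are
already satisfied are ignored, and in every other group each of the `t` members sends `c` coded
packets.  (No load exceeds `n`, so there are at most `n` rounds.) -/
def transmissions (c : ℕ) (Z : Fin n → PacketSet t q) : Finset (Transmission n t q c) :=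
  Finset.univ.filter fun x => ∃ s, (x.1 : ℕ) < load Z (s, x.2.1 s)

/-- The transmission rate of the decentralized scheme: each transmission is one packet, that is
`1 / q ^ t` of the size of a file. -/
noncomputable def rate (c : ℕ) (Z : Fin n → PacketSet t q) : ℝ :=
  ((transmissions c Z).card : ℝ) / (q : ℝ) ^ t

/-- The user that makes a transmission. -/
def sender {c : ℕ} (g : ℕ → PacketSet t q → Fin n) (x : Transmission n t q c) : Fin n :=
  g x.1 (x.2.2.1, x.2.1 x.2.2.1)

/-- The lattice point of the packet that the member of dimension `i` sends to the member of
dimension `s` in its `a`-th coded packet: coordinate `s` of `p` is shifted, modulo `q`, by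
`((s - i) mod t) + a (t - 1)`.  For `c = 1` (so `t = q`) the shift is `s - i` modulo `q`; in general
these shifts run through `1, …, c (t - 1) = q - 1`. -/
def shifted (p : Lattice t q) (i s : Fin t) (a : ℕ) : Lattice t q :=
  Function.update p s
    ⟨((p s : ℕ) + (((s : ℕ) + t - (i : ℕ)) % t + a * (t - 1))) % q, Nat.mod_lt _ (p s).pos⟩

/-- The coded packet sent: the XOR, over the other members of the group, of a packet that they
request; members that are already satisfied request empty packets. -/
def signal {m c B : ℕ} (Z : Fin n → PacketSet t q) (g : ℕ → PacketSet t q → Fin n)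
    (demand : Fin n → Fin m) (W : Library m t q B) (x : Transmission n t q c) : Packet B :=
  ∑ s ∈ Finset.univ.filter (fun s => s ≠ x.2.2.1 ∧ (x.1 : ℕ) < load Z (s, x.2.1 s)),
    W (demand (g x.1 (s, x.2.1 s))) (shifted x.2.1 x.2.2.1 s x.2.2.2)

/-- Two libraries give the same cache content to a user that caches the packet set `z`. -/
def SameCache {m B : ℕ} (z : PacketSet t q) (W W' : Library m t q B) : Prop :=
  ∀ f, ∀ p ∈ hyperplane z, W f p = W' f p

/-- The scheme respects the cache size and satisfies all demands.  "Being a function of" is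
expressed by comparing two libraries. -/
structure Delivers {m : ℕ} (c B : ℕ) (M : ℝ) (r : ℝ) (pos : Fin n → EuclideanSpace ℝ (Fin 2))
    (Z : Fin n → PacketSet t q) (g : ℕ → PacketSet t q → Fin n) (demand : Fin n → Fin m) :
    Prop where
  /-- Each user caches the equivalent of `M` files. -/
  memory : ∀ u, (m : ℝ) * ((hyperplane (Z u)).card : ℝ) = M * (q : ℝ) ^ t
  /-- Each coded packet is a function of the cache content of its sender. -/
  encodable : ∀ x ∈ transmissions c Z, ∀ W W' : Library m t q B,
    SameCache (Z (sender g x)) W W' → signal Z g demand W x = signal Z g demand W' x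
  /-- Each user's requested file is a function of its cache content and of the coded packets sent
  within distance `r`. -/
  decodable : ∀ u, ∀ W W' : Library m t q B, SameCache (Z u) W W' →
    (∀ x ∈ transmissions c Z, dist (pos (sender g x)) (pos u) ≤ r →
      signal Z g demand W x = signal Z g demand W' x) →
    W (demand u) = W' (demand u)

end Delivery

/-- The rate `t / (t - 1) * (m / M) * (1 - M / m)` of the centralized scheme. -/
noncomputable def centralizedRate (m t : ℕ) (M : ℝ) : ℝ :=
  (t : ℝ) / ((t : ℝ) - 1) * ((m : ℝ) / M) * (1 - M / (m : ℝ))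

/-- The probability that all packet sets are cached and that the rate of the decentralized scheme is
at most `κ` times the rate of the centralized one. -/
noncomputable def probRateLe (n m c t q : ℕ) (M κ : ℝ) : ℝ :=
  (placementLaw n t q).real
    {Z | AllCached Z ∧ rate c Z ≤ κ * centralizedRate m t M}

end D2D

/-! Delivery is deterministic. The group of a lattice point `p` is active for as many rounds as the
largest load among the `t` packet sets through `p`, and it sends `c * t` packets per round; `c * t`
is exactly the centralized rate. So the rate is the centralized rate times the average over `p` of
these maxima.

For any level `κ` the maximum is at most `κ` plus the sum of the excesses of the `t` loads over `κ`.
Each hyperplane contains a fraction `1 / q` of the lattice points, so the average is at most `κ`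
plus the total excess divided by `q` (`rate_le`). Loads are binomial with mean `n / n'`, so a
Chernoff estimate bounds the expected total excess (`integral_excess_le`), and Markov's inequality
bounds the chance that it costs more than `δ` (`placementLaw_rate_gt_le`).

Averaging leaves a factor `t` where a union bound over packet sets would have `n' = t * q`. Since `t
≤ √n'`, a Chernoff exponent of `-(log n') / 2` suffices (`le_probRateLe`). This slack gives a
constant factor `19 / 20 < 1` before the square root for large `n`, hence both bounds there; for `n
~ β n' log n'` the exponent at `d log n'` is about `-log n'`. -/

namespace D2D

/-! ### Arithmetic of the parameters. -/

section Parameters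

variable {n' m c t q : ℕ} {M : ℝ}

theorem Params.files_eq (h : Params n' m c t q M) : (m : ℝ) = q * M := by
  rw [h.q_eq, div_mul_cancel₀ _ h.M_pos.ne']

theorem Params.users_eq (h : Params n' m c t q M) : n' = t * q := by
  have hq : (0 : ℝ) < q := by exact_mod_cast h.q_pos
  have h1 := h.t_eq
  rw [h.files_eq, mul_div_mul_right _ _ h.M_pos.ne', eq_div_iff hq.ne'] at h1
  exact_mod_cast h1.symm

theorem Params.points_eq (h : Params n' m c t q M) : q = 1 + c * (t - 1) := by
  have h1 := h.symm
  rw [← h.q_eq] at h1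
  have h2 : 1 ≤ t := by have := h.two_le_t; omega
  have : (q : ℝ) = ((1 + c * (t - 1) : ℕ) : ℝ) := by
    push_cast [Nat.cast_sub h2]; linarith
  exact_mod_cast this

theorem Params.dim_le (h : Params n' m c t q M) : t ≤ q := by
  have h1 := h.points_eq
  have h2 := Nat.le_mul_of_pos_left (t - 1) h.c_pos
  omega

/-- Gives `log t ≤ (log n') / 2`, the saving over a union bound over all packet sets. -/
theorem Params.sq_dim_le (h : Params n' m c t q M) : t ^ 2 ≤ n' := by
  rw [h.users_eq, sq]
  exact Nat.mul_le_mul_left _ h.dim_le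

theorem Params.dim_pos (h : Params n' m c t q M) : 0 < t := by
  have := h.two_le_t; omega

theorem Params.users_pos (h : Params n' m c t q M) : 0 < n' := by
  rw [h.users_eq]
  exact Nat.mul_pos h.dim_pos h.q_pos

/-- `(m / M) * (1 - M / m) = q - 1 = c * (t - 1)`. The result is the number of packets a group sends
per round. -/
theorem Params.centralizedRate_eq (h : Params n' m c t q M) :
    centralizedRate m t M = c * t := by
  have hq : (0 : ℝ) < q := by exact_mod_cast h.q_pos
  have hM := h.M_pos
  have h2 : (2 : ℝ) ≤ t := by exact_mod_cast h.two_le_t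
  have h3 := h.symm
  have h4 : M / (m : ℝ) = 1 / q := by rw [h.q_eq, one_div_div]
  rw [← h.q_eq] at h3
  rw [centralizedRate, h4, ← h.q_eq]
  have h5 : (t : ℝ) - 1 ≠ 0 := by linarith
  field_simp
  linarith

end Parameters

theorem card_hyperplane_mul {t q : ℕ} (z : PacketSet t q) :
    (hyperplane z).card * q = q ^ t := by
  classical
  obtain ⟨i, j⟩ := z
  have h : (hyperplane (i, j)).card = q ^ (t - 1) := by
    have h1 : hyperplane (i, j) = Fintype.piFinset
        (fun s => if s = i then ({j} : Finset (Fin q)) else Finset.univ) := by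
      ext p
      simp only [hyperplane, Finset.mem_filter, Finset.mem_univ, true_and, Fintype.mem_piFinset]
      constructor
      · intro h s
        by_cases hs : s = i
        · subst hs; simp [h]
        · simp [hs]
      · intro h
        simpa using h i
    rw [h1, Fintype.card_piFinset, ← Finset.mul_prod_erase _ _ (Finset.mem_univ i),
      Finset.prod_congr rfl (g := fun _ => q)]
    · simp [Finset.card_erase_of_mem]
    · intro s hs
      simp [(Finset.mem_erase.1 hs).1]
  rw [h, ← pow_succ, Nat.sub_add_cancel]
  exact i.pos

/-! ### Correctness of the delivery and a deterministic bound on its rate. -/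

section Scheme

variable {n t q : ℕ}

theorem load_le (Z : Fin n → PacketSet t q) (z : PacketSet t q) : load Z z ≤ n :=
  (Finset.card_le_univ _).trans_eq (Fintype.card_fin n)

theorem exists_isSchedule {Z : Fin n → PacketSet t q} (hZ : AllCached Z) :
    ∃ g, IsSchedule Z g := by
  classical
  let e : ∀ z, Fin (load Z z) ≃ {u // u ∈ Finset.univ.filter fun u => Z u = z} :=
    fun z => (Finset.equivFin _).symm
  choose w hw using hZ
  refine ⟨fun k z => if h : k < load Z z then (e z ⟨k, h⟩ : Fin n) else w z, ?_, ?_⟩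
  · intro k z
    by_cases h : k < load Z z
    · simp only [h, dite_true]
      exact (Finset.mem_filter.1 (e z ⟨k, h⟩).2).2
    · simp only [h, dite_false]
      exact hw z
  · intro z k hk l hl h
    simp only [Set.mem_Iio] at hk hl
    simp only [hk, hl, dite_true] at h
    simpa using (e z).injective (Subtype.ext h)

/-- Pigeonhole: the first `load` rounds inject into a set of `load` users, so they exhaust it. -/
theorem IsSchedule.exists_round {Z : Fin n → PacketSet t q} {g : ℕ → PacketSet t q → Fin n}
    (hg : IsSchedule Z g) (u : Fin n) : ∃ k < load Z (Z u), g k (Z u) = u := by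
  classical
  have h : (Finset.range (load Z (Z u))).image (fun k => g k (Z u)) =
      Finset.univ.filter fun v => Z v = Z u := by
    apply Finset.eq_of_subset_of_card_le
    · intro v hv
      obtain ⟨k, -, rfl⟩ := Finset.mem_image.1 hv
      simp [hg.caches]
    · rw [Finset.card_image_of_injOn, Finset.card_range]
      · rfl
      · simpa using hg.disjoint (Z u)
  have hu : u ∈ Finset.univ.filter fun v => Z v = Z u := by simp
  rw [← h] at hu
  obtain ⟨k, hk, h⟩ := Finset.mem_image.1 hu
  exact ⟨k, Finset.mem_range.1 hk, h⟩

/-- Only coordinate `s` moves, so every member except the recipient caches the packet; both encoding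
and cancellation of interference rest on this. -/
theorem shifted_mem_hyperplane (p : Lattice t q) {i s s' : Fin t} (h : s' ≠ s) (a : ℕ) :
    shifted p i s a ∈ hyperplane (s', p s') := by
  simp [hyperplane, shifted, Function.update_of_ne h]

/-- A point off the hyperplane `(i, j)` is reached by a shift from a point on it. -/
theorem exists_shifted_eq {c : ℕ} (ht : 2 ≤ t) (hq : q = 1 + c * (t - 1)) (i : Fin t)
    (j : Fin q) (l : Lattice t q) (hl : l i ≠ j) :
    ∃ s : Fin t, s ≠ i ∧ ∃ a : Fin c, shifted (Function.update l i j) s i a = l := by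
  obtain ⟨d, hd0, hdq, hd⟩ : ∃ d, 0 < d ∧ d < q ∧ ((j : ℕ) + d) % q = l i := by
    have h1 := (l i).2
    have h2 := j.2
    have h3 : (l i : ℕ) ≠ j := fun h => hl (Fin.ext h)
    rcases lt_or_gt_of_ne h3 with h | h
    · refine ⟨l i + q - j, by omega, by omega, ?_⟩
      rw [show (j : ℕ) + (l i + q - j) = l i + q by omega, Nat.add_mod_right,
        Nat.mod_eq_of_lt h1]
    · refine ⟨l i - j, by omega, by omega, ?_⟩
      rw [show (j : ℕ) + (l i - j) = l i by omega, Nat.mod_eq_of_lt h1]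
  -- Division of `d - 1` by `t - 1` gives the index `a` of the coded packet and an offset `b + 1` in
  -- `1, …, t - 1`.
  set a := (d - 1) / (t - 1) with ha
  set b := (d - 1) % (t - 1) with hb
  have hdab : (t - 1) * a + b = d - 1 := Nat.div_add_mod _ _
  have hbt : b < t - 1 := Nat.mod_lt _ (by omega)
  have hac : a < c := by
    rw [ha, Nat.div_lt_iff_lt_mul (by omega)]; omega
  have hit := i.2
  -- The sender is the dimension `s` with `i - s ≡ b + 1` modulo `t`; the offset is nonzero, so `s ≠
  -- i`.
  have hs : ∃ s < t, s ≠ i ∧ ((i : ℕ) + t - s) % t = b + 1 := by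
    by_cases h : b + 1 ≤ i
    · refine ⟨i - (b + 1), by omega, by omega, ?_⟩
      rw [show (i : ℕ) + t - (i - (b + 1)) = b + 1 + t by omega, Nat.add_mod_right,
        Nat.mod_eq_of_lt (by omega)]
    · refine ⟨i + t - (b + 1), by omega, by omega, ?_⟩
      rw [show (i : ℕ) + t - (i + t - (b + 1)) = b + 1 by omega, Nat.mod_eq_of_lt (by omega)]
  obtain ⟨s, hst, hsi, hsb⟩ := hs
  refine ⟨⟨s, hst⟩, fun h => hsi (congrArg Fin.val h), ⟨a, hac⟩, ?_⟩
  have hval : b + 1 + a * (t - 1) = d := by rw [mul_comm a]; omega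
  funext x
  by_cases hx : x = i
  · subst hx
    apply Fin.ext
    simp [shifted, hsb, hval, hd]
  · simp [shifted, hx]

theorem dist_le_sqrt_two {x y : EuclideanSpace ℝ (Fin 2)} (hx : ∀ i, x i ∈ Set.Icc (0 : ℝ) 1)
    (hy : ∀ i, y i ∈ Set.Icc (0 : ℝ) 1) : dist x y ≤ Real.sqrt 2 := by
  rw [EuclideanSpace.dist_eq]
  apply Real.sqrt_le_sqrt
  have h : ∀ i, dist (x i) (y i) ^ 2 ≤ 1 := by
    intro i
    rw [Real.dist_eq, sq_abs, sq_le_one_iff_abs_le_one, abs_le]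
    obtain ⟨h1, h2⟩ := hx i
    obtain ⟨h3, h4⟩ := hy i
    constructor <;> linarith
  rw [Fin.sum_univ_two]
  linarith [h 0, h 1]

theorem delivers {n' m c : ℕ} {M : ℝ} (h : Params n' m c t q M) {Z : Fin n → PacketSet t q}
    {g : ℕ → PacketSet t q → Fin n} (hg : IsSchedule Z g) (demand : Fin n → Fin m) (B : ℕ)
    {pos : Fin n → EuclideanSpace ℝ (Fin 2)} {r : ℝ}
    (hpos : ∀ u i, pos u i ∈ Set.Icc (0 : ℝ) 1) (hr : Real.sqrt 2 ≤ r) :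
    Delivers c B M r pos Z g demand where
  memory u := by
    rw [h.files_eq]
    have h1 : ((hyperplane (Z u)).card : ℝ) * q = (q : ℝ) ^ t := by
      exact_mod_cast card_hyperplane_mul (Z u)
    rw [← h1]; ring
  encodable := by
    rintro ⟨k, p, i, a⟩ - W W' hW
    apply Finset.sum_congr rfl
    intro s hs
    simp only [Finset.mem_filter, Finset.mem_univ, true_and] at hs
    apply hW
    rw [sender, hg.caches]
    exact shifted_mem_hyperplane p hs.1.symm a
  decodable := by
    intro u W W' hW hx
    obtain ⟨k, hk, hu⟩ := hg.exists_round u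
    obtain ⟨i, j, hz⟩ : ∃ i j, Z u = (i, j) := ⟨_, _, rfl⟩
    rw [hz] at hk hu hW
    funext l
    by_cases hl : l i = j
    · exact hW _ _ (by simpa [hyperplane] using hl)
    -- A missing packet `l` arrives in the round serving `u`, in the group of the projection of `l`
    -- onto the hyperplane of `u`.
    obtain ⟨s, hs, a, hsa⟩ := exists_shifted_eq h.two_le_t h.points_eq i j l hl
    set p := Function.update l i j with hp
    have hpi : p i = j := by simp [hp]
    let x : Transmission n t q c := (⟨k, hk.trans_le (load_le _ _)⟩, p, s, a)
    have hxt : x ∈ transmissions c Z := by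
      simp only [transmissions, Finset.mem_filter, Finset.mem_univ, true_and]
      exact ⟨i, by simpa [x, hpi] using hk⟩
    have hsig := hx x hxt ((dist_le_sqrt_two (hpos _) (hpos _)).trans hr)
    have hi : i ∈ Finset.univ.filter
        (fun s' => s' ≠ x.2.2.1 ∧ (x.1 : ℕ) < load Z (s', x.2.1 s')) := by
      simp only [Finset.mem_filter, Finset.mem_univ, true_and]
      exact ⟨hs.symm, by simpa [x, hpi] using hk⟩
    -- All summands but the `i`-th are in the cache of `u`, so they agree for `W` and `W'` and
    -- cancel.
    rw [signal, signal, ← Finset.add_sum_erase _ _ hi, ← Finset.add_sum_erase _ _ hi,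
      Finset.sum_congr rfl (g := fun s' =>
        W' (demand (g x.1 (s', x.2.1 s'))) (shifted x.2.1 x.2.2.1 s' x.2.2.2))] at hsig
    · simpa [x, hpi, hu, hsa] using add_right_cancel hsig
    · intro s' hs'
      apply hW
      rw [← hpi]
      exact shifted_mem_hyperplane p (Finset.ne_of_mem_erase hs').symm a

/-- The rate is governed by the average over the lattice points of the maximal load of the
packet sets through the point. -/
theorem rate_le {c : ℕ} (ht : 0 < t) (hq : 0 < q) (Z : Fin n → PacketSet t q) (κ : ℝ) :
    rate c Z ≤ c * t * (κ + (∑ z, max 0 ((load Z z : ℝ) - κ)) / q) := by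
  classical
  have hcard : (transmissions c Z).card =
      ∑ p : Lattice t q,
        (Finset.univ.filter fun k : Fin n => ∃ s, (k : ℕ) < load Z (s, p s)).card * (t * c) := by
    have h1 : transmissions c Z = (Finset.univ : Finset (Lattice t q)).biUnion fun p =>
        (Finset.univ.filter fun k : Fin n => ∃ s, (k : ℕ) < load Z (s, p s)) ×ˢ
          (({p} : Finset (Lattice t q)) ×ˢ (Finset.univ : Finset (Fin t × Fin c))) := by
      ext ⟨k, p, i, a⟩
      simp [transmissions]
    rw [h1, Finset.card_biUnion]
    · simp [Finset.card_product]
    · intro p _ p' _ hpp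
      simp only [Finset.disjoint_left]
      rintro ⟨k, p'', i, a⟩ h h'
      simp only [Finset.mem_product, Finset.mem_singleton] at h h'
      exact hpp (h.2.1.symm.trans h'.2.1)
  have hpoint : ∀ p : Lattice t q,
      ((Finset.univ.filter fun k : Fin n => ∃ s, (k : ℕ) < load Z (s, p s)).card : ℝ) ≤
        κ + ∑ s, max 0 ((load Z (s, p s) : ℝ) - κ) := by
    intro p
    have : Nonempty (Fin t) := ⟨⟨0, ht⟩⟩
    obtain ⟨s₀, hs₀⟩ := Finite.exists_max fun s => load Z (s, p s)
    have h1 : (Finset.univ.filter fun k : Fin n => ∃ s, (k : ℕ) < load Z (s, p s)).card ≤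
        load Z (s₀, p s₀) := by
      rw [← Finset.card_range (load Z (s₀, p s₀))]
      refine Finset.card_le_card_of_injOn Fin.val ?_ Fin.val_injective.injOn
      intro k hk
      simp only [Finset.coe_filter, Finset.mem_univ, true_and, Set.mem_ofPred_eq] at hk
      obtain ⟨s, hs⟩ := hk
      simpa using hs.trans_le (hs₀ s)
    have h2 := Finset.single_le_sum (f := fun s => max 0 ((load Z (s, p s) : ℝ) - κ))
      (fun s _ => le_max_left _ _) (Finset.mem_univ s₀)
    have h3 : (load Z (s₀, p s₀) : ℝ) - κ ≤ max 0 ((load Z (s₀, p s₀) : ℝ) - κ) := le_max_right _ _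
    have h4 : ((Finset.univ.filter fun k : Fin n => ∃ s, (k : ℕ) < load Z (s, p s)).card : ℝ) ≤
        load Z (s₀, p s₀) := by exact_mod_cast h1
    linarith
  have hsum : ∑ p : Lattice t q, ∑ s, max 0 ((load Z (s, p s) : ℝ) - κ) =
      (∑ z, max 0 ((load Z z : ℝ) - κ)) / q * (q : ℝ) ^ t := by
    have hq' : (q : ℝ) ≠ 0 := by positivity
    rw [Finset.sum_comm, Fintype.sum_prod_type, Finset.sum_div, Finset.sum_mul]
    refine Finset.sum_congr rfl fun s _ => ?_
    -- Lattice points are grouped by coordinate `s`: each excess is counted once per point of its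
    -- hyperplane, that is `q ^ t / q` times.
    rw [← Finset.sum_fiberwise (s := Finset.univ) (g := fun p : Lattice t q => p s),
      Finset.sum_div, Finset.sum_mul]
    refine Finset.sum_congr rfl fun j _ => ?_
    have h1 : ((hyperplane (s, j)).card : ℝ) * q = (q : ℝ) ^ t := by
      exact_mod_cast card_hyperplane_mul (s, j)
    rw [Finset.sum_congr rfl (g := fun _ => max 0 ((load Z (s, j) : ℝ) - κ)), Finset.sum_const,
      nsmul_eq_mul, ← h1]
    · rw [hyperplane]; field_simp
    · intro p hp
      rw [(Finset.mem_filter.1 hp).2]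
  have hqt : (0 : ℝ) < (q : ℝ) ^ t := by positivity
  rw [rate, div_le_iff₀ hqt, hcard]
  push_cast
  rw [← Finset.sum_mul]
  calc _ ≤ (∑ p : Lattice t q, (κ + ∑ s, max 0 ((load Z (s, p s) : ℝ) - κ))) * (t * c) :=
        mul_le_mul_of_nonneg_right (Finset.sum_le_sum fun p _ => hpoint p) (by positivity)
    _ = _ := by
        rw [Finset.sum_add_distrib, hsum]
        simp
        ring

end Scheme

/-! ### Probability estimates for the random placement. -/

section Placement

variable {n t q : ℕ}

theorem nonempty_packetSet (ht : 0 < t) (hq : 0 < q) : Nonempty (PacketSet t q) :=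
  ⟨(⟨0, ht⟩, ⟨0, hq⟩)⟩

theorem isProbabilityMeasure_placementLaw (ht : 0 < t) (hq : 0 < q) :
    IsProbabilityMeasure (placementLaw n t q) := by
  have := nonempty_packetSet ht hq
  unfold placementLaw
  infer_instance

theorem uniformOn_univ_real {Ω : Type*} [Fintype Ω] [MeasurableSpace Ω]
    [MeasurableSingletonClass Ω] (x : Ω) :
    (uniformOn (Set.univ : Set Ω)).real {x} = 1 / Fintype.card Ω := by
  rw [measureReal_def, uniformOn_univ, Measure.count_singleton, ENNReal.toReal_div]
  simp

theorem card_packetSet : (Fintype.card (PacketSet t q) : ℝ) = ((t * q : ℕ) : ℝ) := by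
  simp

theorem placementLaw_missing_le (ht : 0 < t) (hq : 0 < q) (z : PacketSet t q) :
    (placementLaw n t q).real {Z | ∀ u, Z u ≠ z} ≤ Real.exp (-(n / (t * q : ℕ))) := by
  have := nonempty_packetSet ht hq
  have h1 : {Z : Fin n → PacketSet t q | ∀ u, Z u ≠ z} = Set.univ.pi fun _ => {z}ᶜ := by
    ext Z; simp
  have h2 : (uniformOn (Set.univ : Set (PacketSet t q))).real {z}ᶜ = 1 - 1 / (t * q : ℕ) := by
    rw [measureReal_compl (measurableSet_singleton z), uniformOn_univ_real, card_packetSet]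
    simp
  rw [placementLaw, h1, measureReal_def, Measure.pi_pi]
  simp only [Finset.prod_const, Finset.card_univ, Fintype.card_fin, ENNReal.toReal_pow]
  rw [← measureReal_def, h2]
  have h3 : (1 : ℝ) / (t * q : ℕ) ≤ 1 := by
    have : (1 : ℝ) ≤ (t * q : ℕ) := by exact_mod_cast Nat.mul_pos ht hq
    rw [div_le_one (by linarith)]
    exact this
  calc (1 - 1 / ((t * q : ℕ) : ℝ)) ^ n ≤ Real.exp (-(1 / (t * q : ℕ))) ^ n :=
        pow_le_pow_left₀ (by linarith) (Real.one_sub_le_exp_neg _) n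
    _ = _ := by rw [← Real.exp_nat_mul]; ring_nf

theorem placementLaw_not_allCached_le (ht : 0 < t) (hq : 0 < q) :
    (placementLaw n t q).real {Z | ¬ AllCached Z} ≤
      (t * q : ℕ) * Real.exp (-(n / (t * q : ℕ))) := by
  have h1 : {Z : Fin n → PacketSet t q | ¬ AllCached Z} = ⋃ z, {Z | ∀ u, Z u ≠ z} := by
    ext Z; simp [AllCached]
  rw [h1]
  refine (measureReal_iUnion_fintype_le _).trans ?_
  refine (Finset.sum_le_sum fun z _ => placementLaw_missing_le ht hq z).trans_eq ?_
  rw [Finset.sum_const, Finset.card_univ, nsmul_eq_mul, card_packetSet]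

/-- The load is a sum of independent indicators, so the exponential moment factorizes over users;
then `1 + x ≤ exp x`. -/
theorem integral_exp_load_le (ht : 0 < t) (hq : 0 < q) (z : PacketSet t q) (l : ℝ) :
    ∫ Z, Real.exp (l * load Z z) ∂placementLaw n t q ≤
      Real.exp (n / (t * q : ℕ) * (Real.exp l - 1)) := by
  classical
  have := nonempty_packetSet ht hq
  have h1 : ∀ Z : Fin n → PacketSet t q, Real.exp (l * load Z z) =
      ∏ u, if Z u = z then Real.exp l else 1 := by
    intro Z
    rw [Finset.prod_ite, Finset.prod_const, Finset.prod_const_one, mul_one, ← Real.exp_nat_mul,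
      mul_comm l]
    rfl
  have h2 : ∫ x, (if x = z then Real.exp l else 1) ∂uniformOn (Set.univ : Set (PacketSet t q)) =
      1 + (Real.exp l - 1) / (t * q : ℕ) := by
    have h4 : (Fintype.card (PacketSet t q) : ℝ) ≠ 0 := by positivity
    rw [integral_fintype .of_finite]
    simp only [uniformOn_univ_real, smul_eq_mul]
    rw [← Finset.mul_sum, Finset.sum_congr rfl (g := fun x : PacketSet t q =>
      (if x = z then Real.exp l - 1 else 0) + 1), Finset.sum_add_distrib, Finset.sum_ite_eq']
    · rw [Finset.sum_const, Finset.card_univ, nsmul_eq_mul, ← card_packetSet]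
      simp only [Finset.mem_univ, if_true]
      field_simp
      ring
    · intro x _
      split_ifs <;> ring
  simp_rw [h1]
  rw [placementLaw, integral_fintype_prod_eq_pow (ι := Fin n)
    (f := fun x : PacketSet t q => if x = z then Real.exp l else 1), h2, Fintype.card_fin]
  have h3 : 0 ≤ 1 + (Real.exp l - 1) / (t * q : ℕ) := by
    rw [← h2]
    refine integral_nonneg fun x => ?_
    dsimp only
    split_ifs
    · exact (Real.exp_pos l).le
    · exact zero_le_one
  calc (1 + (Real.exp l - 1) / ((t * q : ℕ) : ℝ)) ^ n
      ≤ Real.exp ((Real.exp l - 1) / (t * q : ℕ)) ^ n :=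
        pow_le_pow_left₀ h3 (by linarith [Real.add_one_le_exp ((Real.exp l - 1) / (t * q : ℕ))]) n
    _ = _ := by rw [← Real.exp_nat_mul]; ring_nf

/-- A Chernoff bound for the expected excess of the loads over `κ`. -/
theorem integral_excess_le (ht : 0 < t) (hq : 0 < q) {l : ℝ} (hl : 0 < l) (κ : ℝ) :
    ∫ Z, ∑ z, max 0 ((load Z z : ℝ) - κ) ∂placementLaw n t q ≤
      (t * q : ℕ) * (Real.exp (n / (t * q : ℕ) * (Real.exp l - 1) - l * κ) / l) := by
  have := isProbabilityMeasure_placementLaw (n := n) ht hq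
  rw [integral_finsetSum _ fun _ _ => .of_finite]
  have h1 : ∀ z, ∫ Z, max 0 ((load Z z : ℝ) - κ) ∂placementLaw n t q ≤
      Real.exp (n / (t * q : ℕ) * (Real.exp l - 1) - l * κ) / l := by
    intro z
    calc ∫ Z, max 0 ((load Z z : ℝ) - κ) ∂placementLaw n t q
        ≤ ∫ Z, Real.exp (l * load Z z) * (Real.exp (-(l * κ)) / l) ∂placementLaw n t q := by
          refine integral_mono .of_finite .of_finite fun Z => ?_
          dsimp only
          rw [← mul_div_assoc, ← Real.exp_add]
          refine max_le (by positivity) ?_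
          rw [le_div_iff₀ hl]
          -- With `y = l * (load - κ)`, the inequality `y ≤ exp y` bounds the excess by `exp y / l`.
          have := Real.add_one_le_exp (l * load Z z + -(l * κ))
          linarith
      _ ≤ Real.exp (n / (t * q : ℕ) * (Real.exp l - 1)) * (Real.exp (-(l * κ)) / l) := by
          rw [integral_mul_const]
          exact mul_le_mul_of_nonneg_right (integral_exp_load_le ht hq z l) (by positivity)
      _ = _ := by rw [← mul_div_assoc, ← Real.exp_add, ← sub_eq_add_neg]
  refine (Finset.sum_le_sum fun z _ => h1 z).trans_eq ?_
  rw [Finset.sum_const, Finset.card_univ, nsmul_eq_mul, card_packetSet]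

theorem placementLaw_rate_gt_le (ht : 0 < t) (hq : 0 < q) {l δ : ℝ} (hl : 0 < l) (hδ : 0 < δ)
    (c : ℕ) (κ : ℝ) :
    (placementLaw n t q).real {Z | ¬ rate c Z ≤ (κ + δ) * (c * t)} ≤
      t * Real.exp (n / (t * q : ℕ) * (Real.exp l - 1) - l * κ) / (δ * l) := by
  have := isProbabilityMeasure_placementLaw (n := n) ht hq
  have hq' : (0 : ℝ) < q := by exact_mod_cast hq
  have h1 : {Z : Fin n → PacketSet t q | ¬ rate c Z ≤ (κ + δ) * (c * t)} ⊆
      {Z | q * δ ≤ ∑ z, max 0 ((load Z z : ℝ) - κ)} := by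
    intro Z hZ
    by_contra h
    apply hZ
    simp only [Set.mem_ofPred_eq, not_le] at h
    refine (rate_le ht hq Z κ).trans ?_
    rw [mul_comm (κ + δ)]
    refine mul_le_mul_of_nonneg_left ?_ (by positivity)
    rw [add_le_add_iff_left, div_le_iff₀ hq', mul_comm]
    exact h.le
  have h2 := mul_meas_ge_le_integral_of_nonneg (μ := placementLaw n t q)
    (f := fun Z => ∑ z, max 0 ((load Z z : ℝ) - κ))
    (ae_of_all _ fun Z => Finset.sum_nonneg fun z _ => le_max_left _ _) .of_finite (q * δ)
  have h3 := h2.trans (integral_excess_le ht hq hl κ)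
  rw [le_div_iff₀ (by positivity)]
  have h4 := measureReal_mono (μ := placementLaw n t q) h1
  set E := Real.exp (n / (t * q : ℕ) * (Real.exp l - 1) - l * κ)
  calc _ ≤ (placementLaw n t q).real {Z | q * δ ≤ ∑ z, max 0 ((load Z z : ℝ) - κ)} * (δ * l) :=
        mul_le_mul_of_nonneg_right h4 (by positivity)
    _ = (q * δ * (placementLaw n t q).real {Z | q * δ ≤ ∑ z, max 0 ((load Z z : ℝ) - κ)}) *
          (l / q) := by field_simp
    _ ≤ ((t * q : ℕ) * (E / l)) * (l / q) :=
        mul_le_mul_of_nonneg_right h3 (by positivity)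
    _ = t * E := by push_cast; field_simp

theorem le_placementLaw_allCached {n' m c : ℕ} {M β : ℝ} (h : Params n' m c t q M)
    (hn : β * n' * Real.log n' ≤ n) :
    1 - (n' : ℝ) ^ (1 - β) ≤ (placementLaw n t q).real {Z | AllCached Z} := by
  have := isProbabilityMeasure_placementLaw (n := n) h.dim_pos h.q_pos
  have hn' : (0 : ℝ) < n' := by exact_mod_cast h.users_pos
  have h1 := placementLaw_not_allCached_le (n := n) h.dim_pos h.q_pos
  rw [← h.users_eq] at h1
  have h2 : (placementLaw n t q).real {Z | ¬ AllCached Z} =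
      1 - (placementLaw n t q).real {Z | AllCached Z} :=
    probReal_compl_eq_one_sub (Set.toFinite _).measurableSet
  have h3 : (n' : ℝ) * Real.exp (-(n / n')) ≤ (n' : ℝ) ^ (1 - β) := by
    rw [Real.rpow_sub hn', Real.rpow_one, Real.rpow_def_of_pos hn', div_eq_mul_inv _ (Real.exp _),
      ← Real.exp_neg]
    refine mul_le_mul_of_nonneg_left (Real.exp_le_exp.2 ?_) hn'.le
    have : β * Real.log n' ≤ n / n' := by
      rw [le_div_iff₀ hn']; linarith
    linarith
  linarith

/-- A lower bound for the probability that the scheme runs at the given rate. -/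
theorem le_probRateLe {n' m c : ℕ} {M b κ κ' l δ : ℝ} (h : Params n' m c t q M)
    (hn : b * n' * Real.log n' ≤ n) (hl : 0 < l) (hδ : 0 < δ) (hκ : κ + δ ≤ κ')
    (hexp : n / n' * (Real.exp l - 1) - l * κ ≤ -(Real.log n' / 2)) :
    1 - (n' : ℝ) ^ (1 - b) - 1 / (δ * l) ≤ probRateLe n m c t q M κ' := by
  have := isProbabilityMeasure_placementLaw (n := n) h.dim_pos h.q_pos
  have hn' : (0 : ℝ) < n' := by exact_mod_cast h.users_pos
  have h1 := le_placementLaw_allCached h hn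
  have h2 := placementLaw_rate_gt_le (n := n) h.dim_pos h.q_pos hl hδ c κ
  rw [← h.users_eq] at h2
  have ht : t * Real.exp (n / n' * (Real.exp l - 1) - l * κ) ≤ 1 := by
    have h3 : (t : ℝ) ^ 2 ≤ n' := by exact_mod_cast h.sq_dim_le
    have ht0 : (0 : ℝ) < t := by exact_mod_cast h.dim_pos
    -- The factor `t` is absorbed by the exponent `-(log n') / 2`.
    have h4 : Real.log t ≤ Real.log n' / 2 := by
      have := Real.log_le_log (by positivity) h3
      rw [Real.log_pow] at this
      push_cast at this
      linarith
    nth_rewrite 1 [← Real.exp_log ht0]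
    rw [← Real.exp_add, Real.exp_le_one_iff]
    linarith
  have h5 : (placementLaw n t q).real {Z | ¬ rate c Z ≤ (κ + δ) * (c * t)} ≤ 1 / (δ * l) :=
    h2.trans (div_le_div_of_nonneg_right ht (by positivity))
  have h6 : {Z : Fin n → PacketSet t q | AllCached Z} ⊆
      {Z | AllCached Z ∧ rate c Z ≤ κ' * centralizedRate m t M} ∪
        {Z | ¬ rate c Z ≤ (κ + δ) * (c * t)} := by
    intro Z hZ
    by_cases h : rate c Z ≤ (κ + δ) * (c * t)
    · refine Or.inl ⟨hZ, h.trans ?_⟩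
      rw [Params.centralizedRate_eq ‹_›]
      exact mul_le_mul_of_nonneg_right hκ (by positivity)
    · exact Or.inr h
  have h7 := (measureReal_mono (μ := placementLaw n t q) h6).trans (measureReal_union_le _ _)
  rw [probRateLe]
  linarith

end Placement

theorem exp_sub_one_le_of_le {x : ℝ} (h0 : 0 ≤ x) (h1 : x ≤ 2 / 5) :
    Real.exp x - 1 ≤ x + 3 / 5 * x ^ 2 := by
  have h := Real.exp_bound' h0 (by linarith) (n := 3) (by norm_num)
  simp only [Finset.sum_range_succ, Finset.sum_range_zero, Nat.factorial] at h
  norm_num at h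
  -- The cubic remainder is `(2 / 9) * x ^ 3 ≤ (4 / 45) * x ^ 2`, and `1 / 2 + 4 / 45 < 3 / 5`.
  nlinarith [mul_nonneg (sq_nonneg x) (sub_nonneg.2 h1)]

/-! ### The constant `d_β`. -/

section Threshold

/-- The exponent of the Chernoff bound in the regime `n = (β + o(1)) n' log n'` decreases beyond the
mean load. -/
theorem chernoff_exponent_strictAnti {β x y : ℝ} (hβ : 0 < β) (hx : β ≤ x) (hy : x < y) :
    1 + y * (Real.log β - Real.log y + 1) - β < 1 + x * (Real.log β - Real.log x + 1) - β := by
  have hx0 : 0 < x := hβ.trans_le hx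
  have hy0 : 0 < y := hx0.trans hy
  have h1 : Real.log β ≤ Real.log x := Real.log_le_log hβ hx
  have h2 : y - x < y * (Real.log y - Real.log x) := by
    have h3 := Real.log_lt_sub_one_of_pos (x := x / y) (by positivity) (by
      rw [ne_eq, div_eq_one_iff_eq hy0.ne']; exact hy.ne)
    rw [Real.log_div hx0.ne' hy0.ne'] at h3
    have h4 := mul_lt_mul_of_pos_left h3 hy0
    rw [mul_sub y (x / y), mul_div_cancel₀ _ hy0.ne'] at h4
    linarith
  nlinarith [mul_nonneg (sub_nonneg.2 hy.le) (sub_nonneg.2 h1)]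

/-- The function is `1` at `β`, negative at `β * exp 2`, and strictly decreasing beyond `β`, so its
only root there is the largest one. -/
theorem exists_isGreatest_root {β : ℝ} (hβ : 1 < β) :
    ∃ d, β < d ∧ IsGreatest {x : ℝ | 0 < x ∧
      1 + x * (Real.log β - Real.log x + 1) - β = 0} d := by
  have hβ0 : 0 < β := by linarith
  set f : ℝ → ℝ := fun x => 1 + x * (Real.log β - Real.log x + 1) - β with hf
  have h2 : β ≤ β * Real.exp 2 := le_mul_of_one_le_right hβ0.le (Real.one_le_exp (by norm_num))
  have hpos : 0 < f β := by simp [hf]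
  have hcont : ContinuousOn f (Set.Icc β (β * Real.exp 2)) := by
    have : ∀ x ∈ Set.Icc β (β * Real.exp 2), x ≠ 0 := fun x hx => (hβ0.trans_le hx.1).ne'
    fun_prop (disch := assumption)
  have hend : f (β * Real.exp 2) < 0 := by
    simp only [hf]
    rw [Real.log_mul hβ0.ne' (Real.exp_pos _).ne', Real.log_exp]
    have := mul_pos hβ0 (Real.exp_pos 2)
    nlinarith
  obtain ⟨d, hd, hfd⟩ := intermediate_value_Icc' h2 hcont
    (show (0 : ℝ) ∈ Set.Icc _ _ from ⟨hend.le, hpos.le⟩)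
  have hβd : β < d := by
    refine lt_of_le_of_ne hd.1 ?_
    rintro rfl
    exact hpos.ne' hfd
  refine ⟨d, hβd, ⟨hβ0.trans hβd, hfd⟩, ?_⟩
  rintro x ⟨-, hx⟩
  by_contra! h
  exact (chernoff_exponent_strictAnti hβ0 hβd.le h).ne (hx.trans hfd.symm)

end Threshold

/-! ### Rate bound when the mean load is large compared with `log n'`. -/

theorem le_probRateLe_of_large {n n' m c t q : ℕ} {M κ' : ℝ} (h : Params n' m c t q M)
    (hL : 1 ≤ Real.log n') (hn : 8 * (n' * Real.log n') ≤ n)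
    (hκ : (n : ℝ) / n' + 19 / 20 * Real.sqrt (2 * n / n' * Real.log n') ≤ κ') :
    1 - (n' : ℝ) ^ (1 - 2 : ℝ) - 1 / (3 / 40 * Real.log n') ≤ probRateLe n m c t q M κ' := by
  have hn' : (0 : ℝ) < n' := by exact_mod_cast h.users_pos
  set L := Real.log n'
  set μ : ℝ := n / n' with hμ
  have hμL : 8 * L ≤ μ := by rw [hμ, le_div_iff₀ hn']; linarith
  have hμ0 : 0 < μ := by linarith
  set s := Real.sqrt (2 * n / n' * L) with hs
  have hs2 : s ^ 2 = 2 * μ * L := by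
    rw [hs, Real.sq_sqrt (by positivity), hμ]; ring
  have hs0 : 0 < s := by
    rw [hs, mul_div_assoc]
    exact Real.sqrt_pos.2 (mul_pos (mul_pos two_pos hμ0) (by linarith))
  have hl0 : 0 < 3 / 4 * (s / μ) := by positivity
  have hl2 : μ * (3 / 4 * (s / μ)) ^ 2 = 9 / 8 * L := by
    rw [mul_pow, div_pow s μ, hs2]; field_simp; norm_num
  have hl1 : 3 / 4 * (s / μ) ≤ 2 / 5 := by
    refine abs_le_of_sq_le_sq' (a := 3 / 4 * (s / μ)) ?_ (by norm_num) |>.2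
    have : μ * (3 / 4 * (s / μ)) ^ 2 ≤ μ * (2 / 5) ^ 2 := by rw [hl2]; linarith
    exact le_of_mul_le_mul_left this hμ0
  have hls : 3 / 4 * (s / μ) * s = 3 / 2 * L := by
    have : 3 / 4 * (s / μ) * s = 3 / 4 * s ^ 2 / μ := by ring
    rw [this, hs2]; field_simp; ring
  -- With `l = (3 / 4) * (s / μ)` the exponent is at most `(3 / 5) * (9 / 8) * L - (9 / 10) * (3 /
  -- 2) * L = -(27 / 40) * L`, below `-L / 2`; the levels add up to `9 / 10 + 1 / 20 = 19 / 20`.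
  have key := le_probRateLe (b := 2) (κ := μ + 9 / 10 * s) (δ := 1 / 20 * s) (κ' := κ') h (by nlinarith)
    hl0 (by positivity) (by linarith) (by
      have h1 := mul_le_mul_of_nonneg_left (exp_sub_one_le_of_le hl0.le hl1) hμ0.le
      nlinarith)
  have hδ : 1 / 20 * s * (3 / 4 * (s / μ)) = 3 / 40 * L := by
    linear_combination (1 / 20) * hls
  rwa [hδ] at key

theorem probRateLe_le_one {n n' m c t q : ℕ} {M κ : ℝ} (h : Params n' m c t q M) :
    probRateLe n m c t q M κ ≤ 1 := by
  have := isProbabilityMeasure_placementLaw (n := n) h.dim_pos h.q_pos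
  exact measureReal_le_one

/-! ### Passage to the limit in the regimes. -/

section Asymptotics

variable {n n' m c t q : ℕ → ℕ} {M : ℕ → ℝ}

theorem tendsto_log_cast (hn' : Tendsto n' atTop atTop) :
    Tendsto (fun k => Real.log (n' k)) atTop atTop :=
  Real.tendsto_log_atTop.comp (tendsto_natCast_atTop_atTop.comp hn')

theorem tendsto_cast_rpow (hn' : Tendsto n' atTop atTop) {b : ℝ} (hb : 1 < b) :
    Tendsto (fun k => (n' k : ℝ) ^ (1 - b)) atTop (𝓝 0) := by
  have := (tendsto_rpow_neg_atTop (sub_pos.2 hb)).comp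
    (tendsto_natCast_atTop_atTop.comp hn' : Tendsto (fun k => (n' k : ℝ)) atTop atTop)
  simpa [Function.comp_def] using this

theorem tendsto_probRateLe_of_eventually_le
    (h : ∀ k, Params (n' k) (m k) (c k) (t k) (q k) (M k))
    (hn' : Tendsto n' atTop atTop) {b a : ℝ} (hb : 1 < b) (ha : 0 < a) {κ : ℕ → ℝ}
    (hκ : ∀ᶠ k in atTop, 1 - (n' k : ℝ) ^ (1 - b) - 1 / (a * Real.log (n' k)) ≤
      probRateLe (n k) (m k) (c k) (t k) (q k) (M k) (κ k)) :
    Tendsto (fun k => probRateLe (n k) (m k) (c k) (t k) (q k) (M k) (κ k)) atTop (𝓝 1) := by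
  have h1 : Tendsto (fun k => 1 / (a * Real.log (n' k))) atTop (𝓝 0) :=
    tendsto_const_nhds.div_atTop ((tendsto_log_cast hn').const_mul_atTop ha)
  have h2 := (((tendsto_const_nhds (x := (1 : ℝ))).sub (tendsto_cast_rpow hn' hb)).sub h1)
  rw [sub_zero, sub_zero] at h2
  exact tendsto_of_tendsto_of_tendsto_of_le_of_le' h2 tendsto_const_nhds hκ
    (Eventually.of_forall fun k => probRateLe_le_one (h k))

theorem tendsto_probRateLe_of_isLittleO
    (h : ∀ k, Params (n' k) (m k) (c k) (t k) (q k) (M k))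
    (hn' : Tendsto n' atTop atTop)
    (hn : (fun k => (n' k : ℝ) * Real.log (n' k)) =o[atTop] (fun k => (n k : ℝ)))
    {κ : ℕ → ℝ} (hκ : ∀ᶠ k in atTop, (n k : ℝ) / n' k +
      19 / 20 * Real.sqrt (2 * n k / n' k * Real.log (n' k)) ≤ κ k) :
    Tendsto (fun k => probRateLe (n k) (m k) (c k) (t k) (q k) (M k) (κ k)) atTop (𝓝 1) := by
  refine tendsto_probRateLe_of_eventually_le h hn' one_lt_two (show (0 : ℝ) < 3 / 40 by norm_num) ?_
  filter_upwards [hκ, (tendsto_log_cast hn').eventually_ge_atTop 1,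
    hn.bound (show (0 : ℝ) < 1 / 8 by norm_num)] with k hk hL hb
  refine le_probRateLe_of_large (h k) hL ?_ hk
  rw [Real.norm_of_nonneg (by positivity), Real.norm_of_nonneg (by positivity)] at hb
  linarith

theorem tendsto_probRateLe_of_tendsto
    (h : ∀ k, Params (n' k) (m k) (c k) (t k) (q k) (M k))
    (hn' : Tendsto n' atTop atTop) {α β d : ℝ} (hα : 1 < α) (hβ : 1 < β) (hβd : β < d)
    (hd : 1 + d * (Real.log β - Real.log d + 1) - β = 0)
    (hn : Tendsto (fun k => (n k : ℝ) / (n' k * Real.log (n' k))) atTop (𝓝 β)) :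
    Tendsto (fun k => probRateLe (n k) (m k) (c k) (t k) (q k) (M k)
      ((d - 1 + α) * Real.log (n' k))) atTop (𝓝 1) := by
  have hβ0 : 0 < β := by linarith
  have hd0 : 0 < d := by linarith
  -- This `l` minimizes the exponent `β * (exp l - 1) - l * d`; by the equation for `d` the minimum
  -- is `-1`.
  set l := Real.log d - Real.log β with hl
  have hl0 : 0 < l := sub_pos.2 (Real.log_lt_log hβ0 hβd)
  have hexp : β * Real.exp l = d := by
    rw [hl, Real.exp_sub, Real.exp_log hd0, Real.exp_log hβ0, mul_div_cancel₀ _ hβ0.ne']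
  obtain ⟨b, hb1, hbβ⟩ := exists_between hβ
  have hlim : Tendsto (fun k => (n k : ℝ) / (n' k * Real.log (n' k)) * (Real.exp l - 1) - l * d)
      atTop (𝓝 (β * (Real.exp l - 1) - l * d)) := (hn.mul_const _).sub_const _
  have hneg : β * (Real.exp l - 1) - l * d < -(1 / 2) := by
    have : l * d = d * (Real.log d - Real.log β) := mul_comm _ _
    rw [this, mul_sub, hexp]
    linarith
  refine tendsto_probRateLe_of_eventually_le h hn' hb1 (mul_pos (sub_pos.2 hα) hl0) ?_
  filter_upwards [hn.eventually_const_lt hbβ, hlim.eventually_lt_const hneg,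
    (tendsto_log_cast hn').eventually_ge_atTop 1] with k h1 h2 hL
  have hn'0 : (0 : ℝ) < n' k := by exact_mod_cast (h k).users_pos
  have hL0 : 0 < Real.log (n' k) := by linarith
  have key := le_probRateLe (n := n k) (b := b) (κ := d * Real.log (n' k)) (l := l)
    (δ := (α - 1) * Real.log (n' k)) (κ' := (d - 1 + α) * Real.log (n' k)) (h k) (by
      rw [lt_div_iff₀ (by positivity)] at h1; linarith) hl0
      (mul_pos (sub_pos.2 hα) hL0) (by linarith) (by
      have h3 := mul_le_mul_of_nonneg_right h2.le hL0.le
      have h4 : (n k : ℝ) / (n' k * Real.log (n' k)) * Real.log (n' k) = n k / n' k := by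
        field_simp
      rw [← h4]
      linarith)
  rwa [show (α - 1) * Real.log (n' k) * l = (α - 1) * l * Real.log (n' k) by ring] at key

end Asymptotics

end D2D

theorem mainTheorem3 :
    -- all packet sets are cached with probability at least `1 - n' ^ (1 - β)`
    (∀ (n n' m c t q : ℕ) (M β : ℝ), D2D.Params n' m c t q M → 1 < β →
      β * n' * Real.log n' ≤ n →
      1 - (n' : ℝ) ^ (1 - β) ≤
        (D2D.placementLaw n t q).real {Z | D2D.AllCached Z}) ∧
    -- whenever all packet sets are cached, the scheme can be run and it satisfies all demands
    (∀ (n n' m c t q : ℕ) (M : ℝ), D2D.Params n' m c t q M →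
      ∀ Z : Fin n → D2D.PacketSet t q, D2D.AllCached Z →
        (∃ g, D2D.IsSchedule Z g) ∧
        ∀ g, D2D.IsSchedule Z g → ∀ (demand : Fin n → Fin m) (B : ℕ)
          (pos : Fin n → EuclideanSpace ℝ (Fin 2)) (r : ℝ),
          (∀ u i, pos u i ∈ Set.Icc (0 : ℝ) 1) → Real.sqrt 2 ≤ r →
          D2D.Delivers c B M r pos Z g demand) ∧
    -- the bound on the rate, with probability tending to one
    (∃ d : ℝ → ℝ,
      (∀ β : ℝ, 1 < β →
        IsGreatest {x : ℝ | 0 < x ∧ 1 + x * (Real.log β - Real.log x + 1) - β = 0} (d β)) ∧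
      ∀ (n n' m c t q : ℕ → ℕ) (M : ℕ → ℝ),
        (∀ k, D2D.Params (n' k) (m k) (c k) (t k) (q k) (M k)) →
        Tendsto n' atTop atTop →
        ∀ α : ℝ, 1 < α →
          (∀ β : ℝ, 1 < β →
            Tendsto (fun k => (n k : ℝ) / (n' k * Real.log (n' k))) atTop (𝓝 β) →
            Tendsto (fun k => D2D.probRateLe (n k) (m k) (c k) (t k) (q k) (M k)
              ((d β - 1 + α) * Real.log (n' k))) atTop (𝓝 1)) ∧
          ((fun k => (n' k : ℝ) * Real.log (n' k)) =o[atTop] (fun k => (n k : ℝ)) →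
            Tendsto (fun k => D2D.probRateLe (n k) (m k) (c k) (t k) (q k) (M k)
              ((n k : ℝ) / n' k + α * Real.sqrt (2 * n k / n' k * Real.log (n' k))))
              atTop (𝓝 1)) ∧
          ((fun k => (n' k : ℝ) * Real.log (n' k) ^ 3) =o[atTop] (fun k => (n k : ℝ)) →
            Tendsto (fun k => D2D.probRateLe (n k) (m k) (c k) (t k) (q k) (M k)
              ((n k : ℝ) / n' k + Real.sqrt (2 * n k * Real.log (n' k) / n' k) *
                (1 - 1 / α * (Real.log (Real.log (n' k)) / (2 * Real.log (n' k))))))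
              atTop (𝓝 1))) := by
  refine ⟨fun n n' m c t q M β h _ hn => D2D.le_placementLaw_allCached h hn, ?_, ?_⟩
  · intro n n' m c t q M h Z hZ
    exact ⟨D2D.exists_isSchedule hZ, fun g hg demand B pos r hpos hr =>
      D2D.delivers h hg demand B hpos hr⟩
  choose! d hβd hd using fun β (hβ : 1 < β) => D2D.exists_isGreatest_root hβ
  refine ⟨d, hd, ?_⟩
  intro n n' m c t q M h hn' α hα
  have hL := D2D.tendsto_log_cast hn'
  refine ⟨?_, ?_, ?_⟩
  · intro β hβ hn
    exact D2D.tendsto_probRateLe_of_tendsto h hn' hα hβ (hβd β hβ) (hd β hβ).1.2 hn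
  · intro hn
    refine D2D.tendsto_probRateLe_of_isLittleO h hn' hn (Eventually.of_forall fun k => ?_)
    have := Real.sqrt_nonneg (2 * n k / n' k * Real.log (n' k))
    gcongr
    linarith
  · intro hn
    have hlog : Tendsto (fun k => 1 - 1 / α *
        (Real.log (Real.log (n' k)) / (2 * Real.log (n' k)))) atTop (𝓝 1) := by
      have h1 : Tendsto (fun x : ℝ => Real.log x / x) atTop (𝓝 0) :=
        Real.isLittleO_log_id_atTop.tendsto_div_nhds_zero
      have h2 := ((h1.comp hL).const_mul (1 / α * (1 / 2))).const_sub 1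
      rw [mul_zero, sub_zero] at h2
      refine h2.congr fun k => ?_
      simp only [Function.comp_apply]
      ring
    refine D2D.tendsto_probRateLe_of_isLittleO h hn' (IsBigO.trans_isLittleO ?_ hn) ?_
    · refine IsBigO.of_bound 1 ?_
      filter_upwards [hL.eventually_ge_atTop 1] with k hk
      have h3 : Real.log (n' k) ≤ Real.log (n' k) ^ 3 := le_self_pow₀ hk (by norm_num)
      rw [Real.norm_of_nonneg (by positivity), Real.norm_of_nonneg (by positivity), one_mul]
      gcongr
    -- The correction factor tends to `1`, so it eventually exceeds `19 / 20`.
    · filter_upwards [hlog.eventually_const_le (show (19 / 20 : ℝ) < 1 by norm_num)] with k hk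
      rw [mul_comm (19 / 20 : ℝ), div_mul_eq_mul_div (2 * (n k : ℝ))]
      gcongr
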